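/- Let $f\in\mathbb R[x_1,\dots,x_n]$ and let $\bar f(x_1,\dots,x_{n+1})=x_{n+1}^{\deg f}f(x_1/x_{n+1},\dots,x_n/x_{n+1})$ be its homogenization ($\bar f=0$ if $f=0$). With $\mu$ the surface measure on the unit sphere $\mathbb S^{n}\subset\mathbb R^{n+1}$, put, for $w\in\mathbb R^{n+1}$, $$\operatorname{Var}_w(\bar f)=\int_{\mathbb S^n}\bar f(x)^2\,(w^\top x)^2\,d\mu(x),\qquad \operatorname{Cov}(\bar f)=\int_{\mathbb S^n}\bar f(x)^2\,xx^\top\,d\mu(x).$$ Vectors $v_1,\dots,v_n\in\mathbb R^n$ are called principal axes of $f$ if, for each $i$, $v_i$ maximizes $\operatorname{Var}_{[u,0]}(\bar f)$ over all unit vectors $u\in\mathbb R^n$ orthogonal to $v_1,\dots,v_{i-1}$; the numbers $\lambda_i=\operatorname{Var}_{[v_i,0]}(\bar f)$ are the associated principal variances. We say that $f$ has distinct principal variances if principal axes exist and $\lambda_1>\dots>\lambda_n$ for every choice of them. Proposition (Genericity of distinct principal variances). Let $n\ge 2$ and $d\ge 2$. Almost all real polynomials of degree at most $d$ in $n$ variables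 have distinct principal variances. Precisely, identify the polynomials of degree at most $d$ with their coefficient vectors in $\mathbb R^m$, $m=\binom{n+d}{d}$. Then the set of coefficient vectors of those polynomials that do not have distinct principal variances is contained in a proper Zariski-closed subset of $\mathbb R^m$, and has Lebesgue measure zero. Moreover, a polynomial $f$ of degree at most $d$ has distinct principal variances if and only if the leading principal $n\times n$ block of $\operatorname{Cov}(\bar f)$ has $n$ distinct eigenvalues; thus, equivalently, this block has simple eigenvalues for all $f$ outside a proper Zariski-closed set. -/

import Mathlib

open MeasureTheory

noncomputable section

namespace PWPCA

/-! ### Polynomial-weighted variance and covariance -/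

/-- The surface measure on the unit sphere of `ℝ^k`. -/
def sphereMeasure (k : ℕ) : Measure (Metric.sphere (0 : EuclideanSpace ℝ (Fin k)) 1) :=
  (volume : Measure (EuclideanSpace ℝ (Fin k))).toSphere

/-- The value of a real polynomial in `k` variables at a point of `ℝ^k`. -/
def evalAt {k : ℕ} (x : EuclideanSpace ℝ (Fin k)) (p : MvPolynomial (Fin k) ℝ) : ℝ :=
  MvPolynomial.eval (fun i => x i) p

/-- The polynomial-weighted variance along `u`: the integral of `p(x)² (uᵀx)²` over the unit
sphere. Meant for homogeneous `p`; below it is only applied to homogenizations. -/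
def pwVar {k : ℕ} (p : MvPolynomial (Fin k) ℝ) (u : EuclideanSpace ℝ (Fin k)) : ℝ :=
  ∫ x : Metric.sphere (0 : EuclideanSpace ℝ (Fin k)) 1,
    evalAt x.1 p ^ 2 * inner ℝ u x.1 ^ 2 ∂(sphereMeasure k)

/-- The polynomial-weighted covariance matrix: the integral of `p(x)² x xᵀ` over the unit
sphere. -/
def pwCov {k : ℕ} (p : MvPolynomial (Fin k) ℝ) : Matrix (Fin k) (Fin k) ℝ :=
  Matrix.of fun i j => ∫ x : Metric.sphere (0 : EuclideanSpace ℝ (Fin k)) 1,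
    evalAt x.1 p ^ 2 * (x.1 i * x.1 j) ∂(sphereMeasure k)

/-! ### Homogenization and principal variances -/

/-- The homogenization `x_{n+1}^{deg f} f(x_1/x_{n+1}, …, x_n/x_{n+1})`: every term `c x^m` of `f`
becomes `c x^m x_{n+1}^(deg f - |m|)`. The extra variable is the last one. -/
def homogenization {n : ℕ} (f : MvPolynomial (Fin n) ℝ) : MvPolynomial (Fin (n + 1)) ℝ :=
  ∑ m ∈ f.support,
    MvPolynomial.rename Fin.castSucc (MvPolynomial.monomial m (f.coeff m)) *
      MvPolynomial.X (Fin.last n) ^ (f.totalDegree - m.degree)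

/-- The vector `[u, 0]` of `ℝ^(n+1)`. -/
def appendZero {n : ℕ} (u : EuclideanSpace ℝ (Fin n)) : EuclideanSpace ℝ (Fin (n + 1)) :=
  WithLp.toLp 2 (Fin.snoc (α := fun _ => ℝ) (fun i => u i) 0)

/-- The vectors `v 0, …, v (n-1)` form a set of principal axes for `f`: each `v i` maximizes
`u ↦ Var_{[u,0]}` of the homogenization of `f` among the unit vectors `u` of `ℝ^n` that are
orthogonal to `v j` for all `j < i`. -/
def IsPrincipalAxes {n : ℕ} (f : MvPolynomial (Fin n) ℝ)
    (v : Fin n → EuclideanSpace ℝ (Fin n)) : Prop :=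
  ∀ i : Fin n,
    v i ∈ {u : EuclideanSpace ℝ (Fin n) | ‖u‖ = 1 ∧ ∀ j < i, inner ℝ (v j) u = 0} ∧
    IsMaxOn (fun u => pwVar (homogenization f) (appendZero u))
      {u : EuclideanSpace ℝ (Fin n) | ‖u‖ = 1 ∧ ∀ j < i, inner ℝ (v j) u = 0} (v i)

/-- `(lam, v)` is a polynomial-weighted principal component analysis of `f`: `v` is a set of
principal axes and `lam` lists the associated principal variances. -/
def IsPWPCA {n : ℕ} (f : MvPolynomial (Fin n) ℝ) (lam : Fin n → ℝ)
    (v : Fin n → EuclideanSpace ℝ (Fin n)) : Prop :=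
  IsPrincipalAxes f v ∧ ∀ i, lam i = pwVar (homogenization f) (appendZero (v i))

/-- The principal variances of `f` are distinct, `λ_1 > ⋯ > λ_n`. They are attached to a choice of
principal axes, so it is required that a choice exists and that the claim holds for each. -/
def HasDistinctPrincipalVariances {n : ℕ} (f : MvPolynomial (Fin n) ℝ) : Prop :=
  (∃ lam v, IsPWPCA f lam v) ∧ ∀ lam v, IsPWPCA f lam v → StrictAnti lam

/-- The leading principal `n × n` block of the covariance matrix of the homogenization of `f`. -/
def leadingCov {n : ℕ} (f : MvPolynomial (Fin n) ℝ) : Matrix (Fin n) (Fin n) ℝ :=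
  (pwCov (homogenization f)).submatrix Fin.castSucc Fin.castSucc

/-- All eigenvalues of the real symmetric `n × n` matrix `A` are simple, that is, `A` has `n`
distinct (real) eigenvalues. -/
def HasSimpleEigenvalues {n : ℕ} (A : Matrix (Fin n) (Fin n) ℝ) : Prop :=
  ∃ lam : Fin n → ℝ, Function.Injective lam ∧
    ∀ i, Module.End.HasEigenvalue (Matrix.toLin' A) (lam i)

/-! ### The coefficient space of the polynomials of degree at most `d` -/

/-- The exponents of the monomials of degree at most `d` in `n` variables. -/
def exponents (n d : ℕ) : Finset (Fin n →₀ ℕ) :=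
  (Finsupp.finite_of_degree_le (σ := Fin n) d).toFinset

/-- The space `ℝ^m` of coefficient vectors, `m` the number of monomials of degree at most `d`. -/
abbrev CoeffSpace (n d : ℕ) : Type := exponents n d → ℝ

/-- The coefficient vector of a polynomial (to be used in degree at most `d`). -/
def coeffVector {n : ℕ} (d : ℕ) (f : MvPolynomial (Fin n) ℝ) : CoeffSpace n d :=
  fun m => f.coeff m.1

/-- The coefficient vectors of the polynomials of degree at most `d` in `n` variables whose
principal variances are not distinct. -/
def exceptionalSet (n d : ℕ) : Set (CoeffSpace n d) :=
  coeffVector d '' {f : MvPolynomial (Fin n) ℝ |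
    f.totalDegree ≤ d ∧ ¬ HasDistinctPrincipalVariances f}

/-- Zariski-closed subsets of a real affine space. -/
def IsZariskiClosed {σ : Type} (Z : Set (σ → ℝ)) : Prop :=
  ∃ I : Ideal (MvPolynomial σ ℝ), Z = MvPolynomial.zeroLocus ℝ I

end PWPCA

end

/-! On vectors `[u, 0]` the variance is the quadratic form of the leading covariance block `A`.
Successive maximizers of a symmetric form exist and are always an orthonormal eigenbasis, with the
eigenvalues in decreasing order (`IsSuccessiveMax.apply_eq`, `exists_isSuccessiveMax`). So distinct
principal variances mean that `A` has simple spectrum, which is the stated equivalence.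

For genericity, simplicity is certified by one polynomial inequality: if the vectors `A^k 1`, `k <
n`, are independent, the symmetric matrix `A` has simple spectrum
(`hasSimpleEigenvalues_of_det_krylov_ne_zero`). For `f` of degree exactly `d` the entries of `A` are
quadratic forms in the coefficients, so this determinant is a polynomial in them. It is not
identically zero, because the weight `x_{n+1}^(d-2) ∑ i x_i²` gives a diagonal block with distinct
entries (`exists_det_krylov_ne_zero`), where the determinant is of Vandermonde type. Multiplying by
the coefficient of one monomial of degree `d` disposes of the polynomials of lower degree. The zero
set of the product is proper, Zariski-closed and null, and contains the exceptional set. -/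

open MeasureTheory

noncomputable section

namespace PWPCA

/-! ### Successive maxima of a symmetric quadratic form and its spectrum. -/

section Spectral

variable {E : Type*} [NormedAddCommGroup E] [InnerProductSpace ℝ E] {n : ℕ}

/-- Successive maximizers `v 0, …, v (n-1)` of the quadratic form of `T` on unit vectors. -/
def IsSuccessiveMax (T : E →ₗ[ℝ] E) (v : Fin n → E) : Prop :=
  ∀ i : Fin n,
    v i ∈ {u : E | ‖u‖ = 1 ∧ ∀ j < i, inner ℝ (v j) u = 0} ∧
    IsMaxOn (fun u => inner ℝ u (T u)) {u : E | ‖u‖ = 1 ∧ ∀ j < i, inner ℝ (v j) u = 0} (v i)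

/-- First-order condition: a binary quadratic form that is maximal on the unit circle at `(1, 0)`
has no cross term. Testing on the normalization of `(1, t)` gives `2tb ≤ t²(a - c)` for every `t`.
-/
theorem eq_zero_of_forall_circle_le {a b c : ℝ}
    (h : ∀ x y : ℝ, x ^ 2 + y ^ 2 = 1 → x ^ 2 * a + 2 * x * y * b + y ^ 2 * c ≤ a) : b = 0 := by
  have key : ∀ t : ℝ, 2 * t * b ≤ t ^ 2 * (a - c) := by
    intro t
    have hpos : 0 < 1 + t ^ 2 := by positivity
    have hs : Real.sqrt (1 + t ^ 2) ^ 2 = 1 + t ^ 2 := Real.sq_sqrt hpos.le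
    have h1 := h (1 / Real.sqrt (1 + t ^ 2)) (t / Real.sqrt (1 + t ^ 2)) (by
      rw [div_pow, div_pow, hs]; field_simp)
    have h2 : (1 / Real.sqrt (1 + t ^ 2)) ^ 2 * a
        + 2 * (1 / Real.sqrt (1 + t ^ 2)) * (t / Real.sqrt (1 + t ^ 2)) * b
        + (t / Real.sqrt (1 + t ^ 2)) ^ 2 * c = (a + 2 * t * b + t ^ 2 * c) / (1 + t ^ 2) := by
      rw [div_pow, div_pow, hs, mul_assoc 2, div_mul_div_comm, ← sq, hs]
      field_simp
    rw [h2, div_le_iff₀ hpos] at h1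
    nlinarith
  by_contra hb
  have hb2 : 0 < b ^ 2 := by positivity
  -- `M` is a positive upper bound of `a - c`; then `t = b / M` gives `2b²/M ≤ b²/M`.
  set M := |a - c| + 1
  have hM : 0 < M := by positivity
  have hac : a - c ≤ M := by have := le_abs_self (a - c); simp only [M]; linarith
  have h1 := key (b / M)
  have h3 : (b / M) ^ 2 * (a - c) ≤ (b / M) ^ 2 * M :=
    mul_le_mul_of_nonneg_left hac (sq_nonneg _)
  have h4 : (b / M) ^ 2 * M = b ^ 2 / M := by field_simp
  have h5 : 2 * (b / M) * b = 2 * (b ^ 2 / M) := by field_simp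
  have h6 : 0 < b ^ 2 / M := by positivity
  linarith

variable {T : E →ₗ[ℝ] E} {v : Fin n → E}

theorem IsSuccessiveMax.orthonormal (h : IsSuccessiveMax T v) : Orthonormal ℝ v := by
  refine ⟨fun i => (h i).1.1, fun i j hij => ?_⟩
  rcases lt_or_gt_of_ne hij with hlt | hlt
  · exact (h j).1.2 i hlt
  · rw [real_inner_comm]; exact (h i).1.2 j hlt

theorem IsSuccessiveMax.antitone (h : IsSuccessiveMax T v) :
    Antitone fun i => inner ℝ (v i) (T (v i)) := by
  intro i j hij
  exact (h i).2 ⟨(h j).1.1, fun k hk => (h j).1.2 k (hk.trans_le hij)⟩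

/-- For `i < j` the whole unit circle through `v i` and `v j` is admissible at stage `i`, since `v
j` is also orthogonal to all earlier axes. Maximality at `v i` then kills the cross term. -/
theorem IsSuccessiveMax.inner_apply_eq_zero (hT : T.IsSymmetric) (h : IsSuccessiveMax T v)
    {i j : Fin n} (hij : i ≠ j) : inner ℝ (v i) (T (v j)) = 0 := by
  wlog hlt : i < j generalizing i j
  · rw [← hT, real_inner_comm]
    exact this hij.symm (lt_of_le_of_ne (not_lt.mp hlt) hij.symm)
  have ho := h.orthonormal
  have hii : inner ℝ (v i) (v i) = 1 := by rw [real_inner_self_eq_norm_sq, ho.1]; norm_num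
  have hjj : inner ℝ (v j) (v j) = 1 := by rw [real_inner_self_eq_norm_sq, ho.1]; norm_num
  have hij0 : inner ℝ (v i) (v j) = 0 := ho.2 hij
  have hji0 : inner ℝ (v j) (v i) = 0 := ho.2 hij.symm
  have hsym : inner ℝ (v j) (T (v i)) = inner ℝ (v i) (T (v j)) := by
    rw [← hT, real_inner_comm]
  refine eq_zero_of_forall_circle_le (a := inner ℝ (v i) (T (v i)))
    (c := inner ℝ (v j) (T (v j))) fun x y hxy => ?_
  have hmem : x • v i + y • v j ∈ {u : E | ‖u‖ = 1 ∧ ∀ k < i, inner ℝ (v k) u = 0} := by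
    refine ⟨?_, fun k hk => ?_⟩
    · have : ‖x • v i + y • v j‖ ^ 2 = 1 := by
        rw [← real_inner_self_eq_norm_sq]
        simp only [inner_add_left, inner_add_right, real_inner_smul_left, real_inner_smul_right,
          hii, hjj, hij0, hji0]
        linarith
      exact (pow_eq_one_iff_of_nonneg (norm_nonneg _) two_ne_zero).1 this
    · simp only [inner_add_right, real_inner_smul_right, (h i).1.2 k hk,
        (h j).1.2 k (hk.trans hlt), mul_zero, add_zero]
  have := (h i).2 hmem
  simp only [Set.mem_ofPred_eq, map_add, map_smul, inner_add_left, inner_add_right,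
    real_inner_smul_left, real_inner_smul_right, hsym] at this
  linarith

theorem IsSuccessiveMax.apply_eq [FiniteDimensional ℝ E] (hT : T.IsSymmetric) (hn : Module.finrank ℝ E = n)
    (h : IsSuccessiveMax T v) :
    ∃ b : OrthonormalBasis (Fin n) ℝ E, ⇑b = v ∧
      ∀ i, T (v i) = inner ℝ (v i) (T (v i)) • v i := by
  have ho := h.orthonormal
  have hspan : (⊤ : Submodule ℝ E) ≤ Submodule.span ℝ (Set.range v) := by
    rw [ho.linearIndependent.span_eq_top_of_card_eq_finrank' (by simp [hn])]
  refine ⟨OrthonormalBasis.mk ho hspan, by simp, fun i => ?_⟩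
  set b := OrthonormalBasis.mk ho hspan
  have hb : ∀ k, b k = v k := fun k => by simp [b]
  refine (b.sum_repr (T (v i))).symm.trans ?_
  rw [Finset.sum_eq_single i]
  · rw [b.repr_apply_apply, hb]
  · intro k _ hk
    rw [b.repr_apply_apply, hb, h.inner_apply_eq_zero hT hk, zero_smul]
  · simp

/-- An eigenbasis sorted by decreasing eigenvalue works: a unit vector orthogonal to the first
eigenvectors gives a convex combination of the remaining eigenvalues, hence at most the largest of
them. -/
theorem exists_isSuccessiveMax [FiniteDimensional ℝ E] (hT : T.IsSymmetric) (hn : Module.finrank ℝ E = n) :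
    ∃ v : Fin n → E, IsSuccessiveMax T v := by
  set b := hT.eigenvectorBasis hn
  set l := hT.eigenvalues hn
  have hl : Antitone l := hT.eigenvalues_antitone hn
  have hb : ∀ i, T (b i) = l i • b i := fun i => hT.apply_eigenvectorBasis hn i
  have hquad : ∀ u, inner ℝ u (T u) = ∑ k, l k * inner ℝ (b k) u ^ 2 := by
    intro u
    rw [← b.sum_inner_mul_inner]
    refine Finset.sum_congr rfl fun k _ => ?_
    rw [← hT, hb, real_inner_smul_left, real_inner_comm]
    ring
  refine ⟨b, fun i => ⟨⟨b.orthonormal.1 i, fun j hj => b.orthonormal.2 hj.ne⟩, ?_⟩⟩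
  rintro u ⟨hu, hperp⟩
  have hbi : inner ℝ (b i) (T (b i)) = l i := by
    rw [hb, real_inner_smul_right, real_inner_self_eq_norm_sq, b.orthonormal.1]; norm_num
  have hsum : ∑ k, inner ℝ (b k) u ^ 2 = 1 := by
    have := b.sum_sq_norm_inner_right u
    simpa [hu] using this
  simp only [Set.mem_ofPred_eq]
  rw [hbi, hquad]
  calc ∑ k, l k * inner ℝ (b k) u ^ 2 ≤ ∑ k, l i * inner ℝ (b k) u ^ 2 := by
        refine Finset.sum_le_sum fun k _ => ?_
        rcases lt_or_ge k i with hk | hk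
        · simp [hperp k hk]
        · exact mul_le_mul_of_nonneg_right (hl hk) (sq_nonneg _)
    _ = l i := by rw [← Finset.mul_sum, hsum, mul_one]

theorem hasEigenvalue_iff_of_orthonormalBasis (hT : T.IsSymmetric)
    (b : OrthonormalBasis (Fin n) ℝ E) {l : Fin n → ℝ} (hb : ∀ i, T (b i) = l i • b i) (μ : ℝ) :
    Module.End.HasEigenvalue T μ ↔ ∃ i, l i = μ := by
  constructor
  · intro h
    obtain ⟨u, hu⟩ := h.exists_hasEigenvector
    by_contra! hne
    refine hu.2 ?_
    rw [← b.sum_repr u]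
    refine Finset.sum_eq_zero fun i _ => ?_
    have h1 : inner ℝ (b i) (T u) = μ * inner ℝ (b i) u := by
      rw [hu.apply_eq_smul, real_inner_smul_right]
    rw [← hT, hb, real_inner_smul_left] at h1
    have h2 : (l i - μ) * inner ℝ (b i) u = 0 := by linarith
    rw [b.repr_apply_apply, (mul_eq_zero.1 h2).resolve_left (sub_ne_zero.2 (hne i)), zero_smul]
  · rintro ⟨i, rfl⟩
    exact Module.End.hasEigenvalue_of_hasEigenvector
      ⟨Module.End.mem_eigenspace_iff.2 (hb i), b.orthonormal.ne_zero i⟩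

/-- Pigeonhole: `n` distinct eigenvalues, all found among the `n` values `l i`, must exhaust the
indices. -/
theorem exists_injective_hasEigenvalue_iff (hT : T.IsSymmetric)
    (b : OrthonormalBasis (Fin n) ℝ E) {l : Fin n → ℝ} (hb : ∀ i, T (b i) = l i • b i) :
    (∃ m : Fin n → ℝ, Function.Injective m ∧ ∀ i, Module.End.HasEigenvalue T (m i)) ↔
      Function.Injective l := by
  simp only [hasEigenvalue_iff_of_orthonormalBasis hT b hb]
  constructor
  · rintro ⟨m, hm, h⟩
    choose σ hσ using h
    have hinj : Function.Injective (l ∘ σ) := by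
      have : l ∘ σ = m := funext hσ
      rwa [this]
    have hσs : Function.Surjective σ := Finite.surjective_of_injective hinj.of_comp
    intro i j hij
    obtain ⟨i, rfl⟩ := hσs i
    obtain ⟨j, rfl⟩ := hσs j
    rw [hinj hij]
  · exact fun h => ⟨l, h, fun i => ⟨i, rfl⟩⟩

/-- The spectrum of a symmetric operator is simple iff its successive maxima strictly decrease. -/
theorem exists_injective_hasEigenvalue_iff_strictAnti [FiniteDimensional ℝ E] (hT : T.IsSymmetric)
    (hn : Module.finrank ℝ E = n) (h : IsSuccessiveMax T v) :
    (∃ m : Fin n → ℝ, Function.Injective m ∧ ∀ i, Module.End.HasEigenvalue T (m i)) ↔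
      StrictAnti fun i => inner ℝ (v i) (T (v i)) := by
  obtain ⟨b, hbv, hv⟩ := h.apply_eq hT hn
  rw [exists_injective_hasEigenvalue_iff hT b (l := fun i => inner ℝ (v i) (T (v i)))
    (by rw [hbv]; exact hv)]
  exact ⟨fun hi => h.antitone.strictAnti_of_injective hi, fun hs => hs.injective⟩

end Spectral

/-! ### A determinant whose non-vanishing forces simple spectrum. -/

section Krylov

open Matrix

/-- The Krylov matrix of `A`, with columns `A^k 1`, where `1` is the all-ones vector. -/
def krylov {R : Type*} [CommRing R] {n : ℕ} (A : Matrix (Fin n) (Fin n) R) :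
    Matrix (Fin n) (Fin n) R :=
  Matrix.of fun i k => ((A ^ (k : ℕ)) *ᵥ 1) i

theorem det_krylov_map {R S : Type*} [CommRing R] [CommRing S] (φ : R →+* S) {n : ℕ}
    (A : Matrix (Fin n) (Fin n) R) : φ (krylov A).det = (krylov (A.map φ)).det := by
  rw [RingHom.map_det]
  congr 1
  ext i k
  have : (A.map φ) ^ (k : ℕ) = (A ^ (k : ℕ)).map φ := (Matrix.map_pow A φ k).symm
  simp [krylov, this, Matrix.mulVec, dotProduct]

theorem det_krylov_diagonal_ne_zero {n : ℕ} {a : Fin n → ℝ} (ha : Function.Injective a) :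
    (krylov (Matrix.diagonal a)).det ≠ 0 := by
  have : krylov (Matrix.diagonal a) = Matrix.vandermonde a := by
    ext i k
    simp [krylov, Matrix.diagonal_pow, Matrix.mulVec_diagonal, Matrix.vandermonde_apply]
  rw [this]
  exact Matrix.det_vandermonde_ne_zero_iff.2 ha

theorem hasEigenvalue_toEuclideanLin_iff {n : ℕ} (A : Matrix (Fin n) (Fin n) ℝ) (μ : ℝ) :
    Module.End.HasEigenvalue (Matrix.toEuclideanLin A) μ ↔
      Module.End.HasEigenvalue (Matrix.toLin' A) μ := by
  constructor
  · intro h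
    obtain ⟨u, hu, h0⟩ := h.exists_hasEigenvector
    rw [Module.End.mem_eigenspace_iff] at hu
    refine Module.End.hasEigenvalue_of_hasEigenvector (x := WithLp.ofLp u)
      ⟨Module.End.mem_eigenspace_iff.2 ?_, by simpa using h0⟩
    have := congrArg WithLp.ofLp hu
    simpa [Matrix.toLin'_apply] using this
  · intro h
    obtain ⟨u, hu, h0⟩ := h.exists_hasEigenvector
    rw [Module.End.mem_eigenspace_iff] at hu
    refine Module.End.hasEigenvalue_of_hasEigenvector (x := WithLp.toLp 2 u)
      ⟨Module.End.mem_eigenspace_iff.2 ?_, by simpa using h0⟩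
    have := congrArg (WithLp.toLp 2) hu
    simpa [Matrix.toLin'_apply] using this

theorem hasSimpleEigenvalues_iff {n : ℕ} (A : Matrix (Fin n) (Fin n) ℝ) :
    HasSimpleEigenvalues A ↔ ∃ m : Fin n → ℝ, Function.Injective m ∧
      ∀ i, Module.End.HasEigenvalue (Matrix.toEuclideanLin A) (m i) := by
  simp only [hasEigenvalue_toEuclideanLin_iff, HasSimpleEigenvalues]

/-- A repeated eigenvalue has an eigenspace of dimension at least two, which contains a nonzero
vector orthogonal to the all-ones vector. By symmetry it is a left eigenvector, so it lies in the
left kernel of the Krylov matrix. -/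
theorem hasSimpleEigenvalues_of_det_krylov_ne_zero {n : ℕ} {A : Matrix (Fin n) (Fin n) ℝ}
    (hA : A.IsHermitian) (h : (krylov A).det ≠ 0) : HasSimpleEigenvalues A := by
  have hT : (Matrix.toEuclideanLin A).IsSymmetric := Matrix.isSymmetric_toEuclideanLin_iff.2 hA
  have hn : Module.finrank ℝ (EuclideanSpace ℝ (Fin n)) = n := by simp
  set b := hT.eigenvectorBasis hn
  set l := hT.eigenvalues hn
  have hb : ∀ i, Matrix.toEuclideanLin A (b i) = l i • b i :=
    fun i => hT.apply_eigenvectorBasis hn i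
  rw [hasSimpleEigenvalues_iff, exists_injective_hasEigenvalue_iff hT b hb]
  intro i j hij
  by_contra hne
  have hmul : ∀ k, (b k).ofLp ᵥ* A = l k • (b k).ofLp := fun k => by
    have := congrArg WithLp.ofLp (hb k)
    have hAt : Aᵀ = A := by simpa [Matrix.conjTranspose_eq_transpose_of_trivial] using hA.eq
    rw [← Matrix.mulVec_transpose, hAt]
    simpa using this
  set s : ℝ := (b i).ofLp ⬝ᵥ 1
  set t : ℝ := (b j).ofLp ⬝ᵥ 1
  -- a left eigenvector orthogonal to the all-ones vector kills every Krylov vector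
  have key : ∀ p q : ℝ, p * s + q * t = 0 → p • b i + q • b j = 0 := by
    intro p q hpq
    set w : Fin n → ℝ := (p • b i + q • b j).ofLp with hw
    have hw1 : w ⬝ᵥ 1 = 0 := by
      rw [← hpq]; simp [hw, s, t, add_dotProduct]
    have hwA : w ᵥ* A = l i • w := by
      simp only [hw, WithLp.ofLp_add, WithLp.ofLp_smul, Matrix.add_vecMul, Matrix.smul_vecMul,
        hmul, ← hij, smul_add]
      rw [smul_comm p, smul_comm q]
    have hwp : ∀ k : ℕ, w ᵥ* A ^ k = l i ^ k • w := by
      intro k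
      induction k with
      | zero => simp
      | succ k ih => rw [pow_succ, ← Matrix.vecMul_vecMul, ih, Matrix.smul_vecMul, hwA, smul_smul,
          pow_succ]
    have hK : w ᵥ* krylov A = 0 := by
      ext k
      have : (w ᵥ* krylov A) k = w ⬝ᵥ (A ^ (k : ℕ) *ᵥ 1) := rfl
      rw [this, Matrix.dotProduct_mulVec, hwp, smul_dotProduct, hw1]
      simp
    have h0 : w = 0 := Matrix.eq_zero_of_vecMul_eq_zero h hK
    exact (WithLp.ofLp_eq_zero 2).1 h0
  have hli : ∀ p q : ℝ, p • b i + q • b j = 0 → p = 0 ∧ q = 0 := by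
    intro p q h0
    have h1 := congrArg (inner ℝ (b i)) h0
    have h2 := congrArg (inner ℝ (b j)) h0
    simp only [inner_add_right, real_inner_smul_right, orthonormal_iff_ite.1 b.orthonormal,
      inner_zero_right, if_neg hne, if_neg (Ne.symm hne)] at h1 h2
    simpa using And.intro h1 h2
  -- The combination `t • b i - s • b j` is orthogonal to the all-ones vector, so it vanishes and `s
  -- = 0`; then `b i` itself is orthogonal to that vector and would have to vanish.
  have h1 := hli t (-s) (key t (-s) (by ring))
  have h2 := hli 1 0 (key 1 0 (by simp only [show s = 0 by linarith [h1.2]]; ring))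
  exact one_ne_zero h2.1

end Krylov

/-! ### Zero sets of nonzero polynomials are null. -/

section ZeroSet

theorem measurableSet_eval_eq_zero {σ : Type*} [Fintype σ] (p : MvPolynomial σ ℝ) :
    MeasurableSet {x : σ → ℝ | MvPolynomial.eval x p = 0} :=
  (isClosed_eq (MvPolynomial.continuous_eval p) continuous_const).measurableSet

/-- Induction with Fubini: `p` is read as a polynomial in the first variable. Its leading
coefficient is nonzero off a null set of the other variables, and there each slice is a finite set
of roots. -/
theorem volume_eval_eq_zero_fin : ∀ {n : ℕ} {p : MvPolynomial (Fin n) ℝ}, p ≠ 0 →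
    volume {x : Fin n → ℝ | MvPolynomial.eval x p = 0} = 0
  | 0, p, hp => by
    have : {x : Fin 0 → ℝ | MvPolynomial.eval x p = 0} = ∅ := by
      refine Set.eq_empty_of_forall_notMem fun x hx => hp (MvPolynomial.funext fun y => ?_)
      rw [Subsingleton.elim y x, map_zero]
      exact hx
    rw [this, measure_empty]
  | n + 1, p, hp => by
    set S' : Set (ℝ × (Fin n → ℝ)) :=
      {z | Polynomial.eval z.1 (Polynomial.map (MvPolynomial.eval z.2)
        (MvPolynomial.finSuccEquiv ℝ n p)) = 0} with hS'
    have hcons : S' = {z | MvPolynomial.eval (Fin.cons z.1 z.2 : Fin (n + 1) → ℝ) p = 0} := by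
      ext z
      simp only [hS', Set.mem_ofPred_eq, MvPolynomial.eval_eq_eval_mv_eval']
    have hmeas : MeasurableSet S' := by
      rw [hcons]
      refine (isClosed_eq ((MvPolynomial.continuous_eval p).comp ?_)
        continuous_const).measurableSet
      exact continuous_pi fun i => Fin.cases (by simpa using continuous_fst)
        (fun j => by simpa using by fun_prop) i
    have hpre : {x : Fin (n + 1) → ℝ | MvPolynomial.eval x p = 0} =
        MeasurableEquiv.piFinSuccAbove (fun _ => ℝ) 0 ⁻¹' S' := by
      ext x
      rw [hcons]
      simp [MeasurableEquiv.piFinSuccAbove]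
    have hq : MvPolynomial.finSuccEquiv ℝ n p ≠ 0 := by simpa using hp
    set q := (MvPolynomial.finSuccEquiv ℝ n p).leadingCoeff
    have hq0 : q ≠ 0 := Polynomial.leadingCoeff_ne_zero.2 hq
    rw [hpre, (volume_preserving_piFinSuccAbove (fun _ => ℝ) 0).measure_preimage
      hmeas.nullMeasurableSet, Measure.volume_eq_prod, Measure.prod_apply_symm hmeas]
    have hae : (fun s : Fin n → ℝ => (volume : Measure ℝ) ((fun y => (y, s)) ⁻¹' S'))
        =ᵐ[volume] fun _ => 0 := by
      have hnull : ∀ᵐ s : Fin n → ℝ, MvPolynomial.eval s q ≠ 0 := by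
        rw [ae_iff]
        simpa using volume_eval_eq_zero_fin hq0
      filter_upwards [hnull] with s hs
      have hne : Polynomial.map (MvPolynomial.eval s) (MvPolynomial.finSuccEquiv ℝ n p) ≠ 0 := by
        intro h0
        have := congrArg
          (fun r => Polynomial.coeff r (MvPolynomial.finSuccEquiv ℝ n p).natDegree) h0
        simp only [Polynomial.coeff_map, Polynomial.coeff_zero] at this
        exact hs this
      refine Set.Finite.measure_zero ?_ _
      refine (Polynomial.finite_setOfPred_isRoot hne).subset fun y hy => ?_
      exact hy
    rw [lintegral_congr_ae hae, lintegral_zero]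

/-- The zero set of a nonzero real polynomial is Lebesgue-null. -/
theorem volume_eval_eq_zero {σ : Type} [Fintype σ] {p : MvPolynomial σ ℝ} (hp : p ≠ 0) :
    volume {x : σ → ℝ | MvPolynomial.eval x p = 0} = 0 := by
  set e := (Fintype.equivFin σ).symm
  have hne : MvPolynomial.rename e.symm p ≠ 0 := 
    (MvPolynomial.rename_injective _ e.symm.injective).ne_iff' (map_zero _) |>.2 hp
  rw [← (volume_measurePreserving_piCongrLeft (fun _ => ℝ) e).measure_preimage
    (measurableSet_eval_eq_zero p).nullMeasurableSet]
  refine (congrArg volume ?_).trans (volume_eval_eq_zero_fin hne)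
  ext x
  simp only [Set.mem_preimage, Set.mem_ofPred_eq, MvPolynomial.eval_rename]
  have : (MeasurableEquiv.piCongrLeft (fun _ => ℝ) e) x = x ∘ e.symm := by
    ext i
    obtain ⟨j, rfl⟩ := e.surjective i
    simp [MeasurableEquiv.coe_piCongrLeft]
  rw [this]

end ZeroSet

/-! ### Integrals on the sphere, and variance as a quadratic form. -/

section Sphere

variable {k n : ℕ}

theorem continuous_evalAt (p : MvPolynomial (Fin k) ℝ) :
    Continuous fun x : EuclideanSpace ℝ (Fin k) => evalAt x p :=
  (MvPolynomial.continuous_eval p).comp (by fun_prop)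

instance : IsFiniteMeasure (sphereMeasure k) := by unfold sphereMeasure; infer_instance

instance : (sphereMeasure k).IsOpenPosMeasure := by unfold sphereMeasure; infer_instance

theorem integrable_sphere {F : EuclideanSpace ℝ (Fin k) → ℝ} (hF : Continuous F) :
    Integrable (fun x : Metric.sphere (0 : EuclideanSpace ℝ (Fin k)) 1 => F x.1)
      (sphereMeasure k) :=
  (hF.comp continuous_subtype_val).integrable_of_hasCompactSupport
    (HasCompactSupport.of_compactSpace _)

/-- The action of a linear isometry on the unit sphere. -/
def sphereHomeomorph (T : EuclideanSpace ℝ (Fin k) ≃ₗᵢ[ℝ] EuclideanSpace ℝ (Fin k)) :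
    Metric.sphere (0 : EuclideanSpace ℝ (Fin k)) 1 ≃ₜ
      Metric.sphere (0 : EuclideanSpace ℝ (Fin k)) 1 :=
  T.toHomeomorph.subtype fun x => by simp

-- `toSphere` measures a set, up to a constant factor, by the volume of the cone over it; an
-- isometry carries cones to cones and preserves volume.
open scoped Pointwise in
theorem measurePreserving_sphereHomeomorph
    (T : EuclideanSpace ℝ (Fin k) ≃ₗᵢ[ℝ] EuclideanSpace ℝ (Fin k)) :
    MeasurePreserving (sphereHomeomorph T) (sphereMeasure k) (sphereMeasure k) := by
  have hm : Measurable (sphereHomeomorph T) := (sphereHomeomorph T).continuous.measurable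
  refine ⟨hm, Measure.ext fun s hs => ?_⟩
  rw [Measure.map_apply hm hs, sphereMeasure, Measure.toSphere_apply' _ hs,
    Measure.toSphere_apply' _ (hm hs)]
  congr 1
  have : Set.Ioo (0 : ℝ) 1 • ((↑) '' (sphereHomeomorph T ⁻¹' s)) =
      T ⁻¹' (Set.Ioo (0 : ℝ) 1 • ((↑) '' s : Set (EuclideanSpace ℝ (Fin k)))) := by
    ext x
    simp only [Set.mem_smul, Set.mem_preimage, Set.mem_image]
    constructor
    · rintro ⟨r, hr, _, ⟨y, hy, rfl⟩, rfl⟩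
      exact ⟨r, hr, _, ⟨_, hy, rfl⟩, (T.map_smul r y.1).symm⟩
    · rintro ⟨r, hr, _, ⟨y, hy, rfl⟩, h⟩
      refine ⟨r, hr, _, ⟨(sphereHomeomorph T).symm y, by simpa using hy, rfl⟩, ?_⟩
      apply T.injective
      rw [T.map_smul, ← h]
      congr 1
      exact congrArg Subtype.val ((sphereHomeomorph T).apply_symm_apply y)
  rw [this]
  exact MeasurePreserving.measure_preimage_equiv (f := T.toHomeomorph.toMeasurableEquiv)
    T.measurePreserving _

theorem integral_sphere_comp (T : EuclideanSpace ℝ (Fin k) ≃ₗᵢ[ℝ] EuclideanSpace ℝ (Fin k))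
    (F : EuclideanSpace ℝ (Fin k) → ℝ) :
    ∫ x : Metric.sphere (0 : EuclideanSpace ℝ (Fin k)) 1, F (T x.1) ∂(sphereMeasure k) =
      ∫ x : Metric.sphere (0 : EuclideanSpace ℝ (Fin k)) 1, F x.1 ∂(sphereMeasure k) :=
  (measurePreserving_sphereHomeomorph T).integral_comp
    (sphereHomeomorph T).measurableEmbedding fun x => F x.1

/-- The leading `n × n` block of the covariance matrix on the sphere with weight `g²`. -/
def blockCov (g : EuclideanSpace ℝ (Fin (n + 1)) → ℝ) : Matrix (Fin n) (Fin n) ℝ :=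
  Matrix.of fun i j => ∫ x : Metric.sphere (0 : EuclideanSpace ℝ (Fin (n + 1))) 1,
    g x.1 ^ 2 * (x.1 i.castSucc * x.1 j.castSucc) ∂(sphereMeasure (n + 1))

theorem leadingCov_eq_blockCov (f : MvPolynomial (Fin n) ℝ) :
    leadingCov f = blockCov fun x => evalAt x (homogenization f) := rfl

theorem isHermitian_blockCov (g : EuclideanSpace ℝ (Fin (n + 1)) → ℝ) :
    (blockCov g).IsHermitian := by
  ext i j
  simp [blockCov, mul_comm]

theorem inner_appendZero (u : EuclideanSpace ℝ (Fin n)) (x : EuclideanSpace ℝ (Fin (n + 1))) :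
    inner ℝ (appendZero u) x = ∑ i, u i * x i.castSucc := by
  simp [PiLp.inner_apply, appendZero, Fin.sum_univ_castSucc, mul_comm]

theorem pwVar_appendZero (f : MvPolynomial (Fin n) ℝ) (u : EuclideanSpace ℝ (Fin n)) :
    pwVar (homogenization f) (appendZero u) =
      inner ℝ u (Matrix.toEuclideanLin (leadingCov f) u) := by
  have hc := continuous_evalAt (homogenization f)
  have h1 : ∀ x : EuclideanSpace ℝ (Fin (n + 1)),
      evalAt x (homogenization f) ^ 2 * inner ℝ (appendZero u) x ^ 2 =
        ∑ i, ∑ j, u i * u j *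
          (evalAt x (homogenization f) ^ 2 * (x i.castSucc * x j.castSucc)) := by
    intro x
    rw [inner_appendZero, sq (∑ i, _), Finset.sum_mul_sum, Finset.mul_sum]
    refine Finset.sum_congr rfl fun i _ => ?_
    rw [Finset.mul_sum]
    exact Finset.sum_congr rfl fun j _ => by ring
  unfold pwVar
  simp only [h1]
  rw [integral_finsetSum _ fun i _ => integrable_sphere
    (F := fun x => ∑ j, u i * u j *
      (evalAt x (homogenization f) ^ 2 * (x i.castSucc * x j.castSucc))) (by fun_prop)]
  simp only [PiLp.inner_apply, Matrix.toLpLin_apply, Matrix.mulVec, dotProduct,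
    RCLike.inner_apply, conj_trivial]
  refine Finset.sum_congr rfl fun i _ => ?_
  rw [integral_finsetSum _ fun j _ => integrable_sphere
    (F := fun x => u i * u j *
      (evalAt x (homogenization f) ^ 2 * (x i.castSucc * x j.castSucc))) (by fun_prop),
    Finset.sum_mul]
  refine Finset.sum_congr rfl fun j _ => ?_
  rw [integral_const_mul, leadingCov_eq_blockCov, blockCov, Matrix.of_apply]
  ring

theorem isPrincipalAxes_iff (f : MvPolynomial (Fin n) ℝ) (v : Fin n → EuclideanSpace ℝ (Fin n)) :
    IsPrincipalAxes f v ↔ IsSuccessiveMax (Matrix.toEuclideanLin (leadingCov f)) v := by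
  simp only [IsPrincipalAxes, IsSuccessiveMax, pwVar_appendZero]

/-- Principal axes always exist, and by `key` any one choice already decides whether the spectrum is
simple; hence "some choice" and "every choice" agree. -/
theorem hasDistinctPrincipalVariances_iff (f : MvPolynomial (Fin n) ℝ) :
    HasDistinctPrincipalVariances f ↔ HasSimpleEigenvalues (leadingCov f) := by
  have hT : (Matrix.toEuclideanLin (leadingCov f)).IsSymmetric :=
    Matrix.isSymmetric_toEuclideanLin_iff.2
      (leadingCov_eq_blockCov f ▸ isHermitian_blockCov _)
  have hn : Module.finrank ℝ (EuclideanSpace ℝ (Fin n)) = n := by simp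
  have key : ∀ lam v, IsPWPCA f lam v →
      (HasSimpleEigenvalues (leadingCov f) ↔ StrictAnti lam) := by
    rintro lam v ⟨hv, hlam⟩
    rw [hasSimpleEigenvalues_iff, exists_injective_hasEigenvalue_iff_strictAnti hT hn
      ((isPrincipalAxes_iff f v).1 hv), funext hlam]
    simp only [pwVar_appendZero]
  obtain ⟨v, hv⟩ := exists_isSuccessiveMax hT hn
  have hex : IsPWPCA f _ v := ⟨(isPrincipalAxes_iff f v).2 hv, fun i => rfl⟩
  exact ⟨fun h => (key _ v hex).2 (h.2 _ v hex),
    fun h => ⟨⟨_, v, hex⟩, fun lam w hw => (key lam w hw).1 h⟩⟩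

end Sphere

/-! ### The covariance block as a polynomial function of the coefficients. -/

section Generic

variable {n d : ℕ}

theorem mem_exponents {m : Fin n →₀ ℕ} : m ∈ exponents n d ↔ m.degree ≤ d := by
  simp [exponents]

/-- The monomial `x^m`, homogenized to degree `d`, as a function on `ℝ^(n+1)`. -/
def homMonomial (d : ℕ) (m : Fin n →₀ ℕ) (x : EuclideanSpace ℝ (Fin (n + 1))) : ℝ :=
  (∏ i, x i.castSucc ^ m i) * x (Fin.last n) ^ (d - m.degree)

theorem continuous_homMonomial (m : Fin n →₀ ℕ) : Continuous (homMonomial d m) := by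
  unfold homMonomial
  fun_prop

/-- The form of degree `d` on `ℝ^(n+1)` with coefficient vector `c`. -/
def homForm (c : CoeffSpace n d) (x : EuclideanSpace ℝ (Fin (n + 1))) : ℝ :=
  ∑ m, c m * homMonomial d m.1 x

/-- The exact degree is needed: `homogenization` pads to `f.totalDegree`, whereas `homForm` pads to
the fixed `d`. -/
theorem evalAt_homogenization (f : MvPolynomial (Fin n) ℝ) (hf : f.totalDegree = d)
    (x : EuclideanSpace ℝ (Fin (n + 1))) :
    evalAt x (homogenization f) = homForm (coeffVector d f) x := by
  have hsub : f.support ⊆ exponents n d := fun m hm => by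
    rw [mem_exponents, ← hf, Finsupp.degree_eq_sum, ← Finsupp.sum_fintype m (fun _ e => e) (by simp)]
    exact MvPolynomial.le_totalDegree hm
  have hterm : ∀ m : Fin n →₀ ℕ, MvPolynomial.eval (fun i => x i)
      (MvPolynomial.rename Fin.castSucc (MvPolynomial.monomial m (f.coeff m)) *
        MvPolynomial.X (Fin.last n) ^ (f.totalDegree - m.degree)) =
      f.coeff m * homMonomial d m x := by
    intro m
    rw [map_mul, MvPolynomial.eval_rename, MvPolynomial.eval_monomial, map_pow,
      MvPolynomial.eval_X, hf, Finsupp.prod_fintype _ _ (by simp), homMonomial, mul_assoc]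
    rfl
  rw [evalAt, homogenization, map_sum, Finset.sum_congr rfl fun m _ => hterm m,
    Finset.sum_subset hsub fun m _ hm => by rw [MvPolynomial.notMem_support_iff.1 hm, zero_mul],
    homForm]
  exact (Finset.sum_coe_sort (exponents n d) fun m => f.coeff m * homMonomial d m x).symm

/-- The matrix `blockCov (homForm c)`, as a matrix of polynomials in `c`. -/
def genericCov (n d : ℕ) : Matrix (Fin n) (Fin n) (MvPolynomial (exponents n d) ℝ) :=
  Matrix.of fun i j => ∑ m, ∑ m',
    MvPolynomial.C (∫ x : Metric.sphere (0 : EuclideanSpace ℝ (Fin (n + 1))) 1,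
      homMonomial d m.1 x.1 * homMonomial d m'.1 x.1 * (x.1 i.castSucc * x.1 j.castSucc)
        ∂(sphereMeasure (n + 1))) * (MvPolynomial.X m * MvPolynomial.X m')

theorem genericCov_map (c : CoeffSpace n d) :
    (genericCov n d).map (MvPolynomial.eval c) = blockCov (homForm c) := by
  ext i j
  have hc := continuous_homMonomial (n := n) (d := d)
  have h1 : ∀ x : EuclideanSpace ℝ (Fin (n + 1)),
      homForm c x ^ 2 * (x i.castSucc * x j.castSucc) =
        ∑ m : exponents n d, ∑ m' : exponents n d, c m * c m' *
          (homMonomial d m.1 x * homMonomial d m'.1 x * (x i.castSucc * x j.castSucc)) := by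
    intro x
    rw [homForm, sq, Finset.sum_mul_sum, Finset.sum_mul]
    refine Finset.sum_congr rfl fun m _ => ?_
    rw [Finset.sum_mul]
    exact Finset.sum_congr rfl fun m' _ => by ring
  simp only [genericCov, blockCov, Matrix.map_apply, Matrix.of_apply, h1, map_sum, map_mul,
    MvPolynomial.eval_C, MvPolynomial.eval_X]
  rw [integral_finsetSum _ fun m _ => integrable_sphere
    (F := fun x => ∑ m' : exponents n d, c m * c m' *
      (homMonomial d m.1 x * homMonomial d m'.1 x * (x i.castSucc * x j.castSucc)))
    (by fun_prop)]
  refine Finset.sum_congr rfl fun m _ => ?_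
  rw [integral_finsetSum _ fun m' _ => integrable_sphere
    (F := fun x => c m * c m' *
      (homMonomial d m.1 x * homMonomial d m'.1 x * (x i.castSucc * x j.castSucc)))
    (by fun_prop)]
  refine Finset.sum_congr rfl fun m' _ => ?_
  rw [integral_const_mul]
  ring

end Generic

/-! ### A weight whose covariance block is diagonal with distinct entries. -/

section Witness

variable {n : ℕ}

/-- The weighted sum of squares `∑ i * x_i²` of the first `n` coordinates. -/
def weightedSq (x : EuclideanSpace ℝ (Fin (n + 1))) : ℝ :=
  ∑ i : Fin n, (i : ℝ) * x i.castSucc ^ 2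

/-- The form `x_{n+1}^e ∑ i * x_i²`. -/
def weightedForm (e : ℕ) (x : EuclideanSpace ℝ (Fin (n + 1))) : ℝ :=
  x (Fin.last n) ^ e * weightedSq x

theorem continuous_weightedForm (e : ℕ) : Continuous (weightedForm (n := n) e) := by
  unfold weightedForm weightedSq
  fun_prop

theorem weightedSq_nonneg (x : EuclideanSpace ℝ (Fin (n + 1))) : 0 ≤ weightedSq x :=
  Finset.sum_nonneg fun _ _ => by positivity

theorem exists_homForm_eq_weightedForm {d : ℕ} (hd : 2 ≤ d) :
    ∃ c : CoeffSpace n d, homForm c = weightedForm (d - 2) := by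
  let m : Fin n → exponents n d := fun i =>
    ⟨Finsupp.single i 2, mem_exponents.2 (by simpa using hd)⟩
  -- These are the coefficients of a quadratic polynomial, padded to degree `d`. For `d > 2` the
  -- resulting form is not its homogenization, which is harmless: only a point where the determinant
  -- is nonzero is wanted.
  refine ⟨∑ i : Fin n, ((i : ℕ) : ℝ) • Pi.single (m i) 1, funext fun x => ?_⟩
  have hm : ∀ i, homMonomial d (m i).1 x = x i.castSucc ^ 2 * x (Fin.last n) ^ (d - 2) := by
    intro i
    simp only [homMonomial, m, Finsupp.degree_single]
    rw [Finset.prod_eq_single i (by intro j _ hj; simp [Finsupp.single_eq_of_ne hj]) (by simp)]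
    simp
  simp only [homForm, Finset.sum_apply, Finset.sum_mul, Pi.smul_apply, smul_eq_mul]
  rw [Finset.sum_comm, weightedForm, weightedSq, Finset.mul_sum]
  refine Finset.sum_congr rfl fun i _ => ?_
  rw [Finset.sum_eq_single (m i) (by intro k _ hk; simp [Pi.single_eq_of_ne hk]) (by simp), hm]
  simp
  ring

/-- The reflection `x_i ↦ -x_i` preserves the weight and changes the sign of the integrand. -/
theorem blockCov_weightedForm_offDiag (e : ℕ) {i j : Fin n} (hij : i ≠ j) :
    blockCov (weightedForm e) i j = 0 := by
  let T : EuclideanSpace ℝ (Fin (n + 1)) ≃ₗᵢ[ℝ] EuclideanSpace ℝ (Fin (n + 1)) :=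
    LinearIsometryEquiv.piLpCongrRight 2 fun k =>
      if k = i.castSucc then LinearIsometryEquiv.neg ℝ else LinearIsometryEquiv.refl ℝ ℝ
  have hT : ∀ x k, T x k = if k = i.castSucc then -x k else x k := by
    intro x k
    simp only [T, LinearIsometryEquiv.piLpCongrRight_apply]
    split_ifs <;> simp
  have hw : ∀ x, weightedForm e (T x) = weightedForm e x := by
    intro x
    simp only [weightedForm, weightedSq, hT, (Fin.castSucc_lt_last i).ne', if_false]
    congr 1
    exact Finset.sum_congr rfl fun k _ => by split_ifs <;> simp
  have h := integral_sphere_comp T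
    fun x => weightedForm e x ^ 2 * (x i.castSucc * x j.castSucc)
  have hji : j.castSucc ≠ i.castSucc := fun h => hij (Fin.castSucc_injective n h).symm
  simp only [hw, hT, if_true, if_neg hji, neg_mul, mul_neg, integral_neg] at h
  simp only [blockCov, Matrix.of_apply]
  linarith

theorem weightedSq_swap {k l : Fin n} (hkl : k < l) :
    ∃ T : EuclideanSpace ℝ (Fin (n + 1)) ≃ₗᵢ[ℝ] EuclideanSpace ℝ (Fin (n + 1)), ∀ x,
      T x k.castSucc = x l.castSucc ∧ T x l.castSucc = x k.castSucc ∧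
      T x (Fin.last n) = x (Fin.last n) ∧
      weightedSq x - weightedSq (T x) =
        ((l : ℝ) - k) * (x l.castSucc ^ 2 - x k.castSucc ^ 2) := by
  let T : EuclideanSpace ℝ (Fin (n + 1)) ≃ₗᵢ[ℝ] EuclideanSpace ℝ (Fin (n + 1)) :=
    LinearIsometryEquiv.piLpCongrLeft 2 ℝ ℝ (Equiv.swap k.castSucc l.castSucc)
  have hT : ∀ x i, T x i = x (Equiv.swap k.castSucc l.castSucc i) := by
    intro x i
    simp [T, LinearIsometryEquiv.piLpCongrLeft_apply, Equiv.piCongrLeft']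
  have hk : ∀ x, T x k.castSucc = x l.castSucc := fun x => by rw [hT, Equiv.swap_apply_left]
  have hl : ∀ x, T x l.castSucc = x k.castSucc := fun x => by rw [hT, Equiv.swap_apply_right]
  refine ⟨T, fun x => ⟨hk x, hl x, ?_, ?_⟩⟩
  · rw [hT, Equiv.swap_apply_of_ne_of_ne (Fin.castSucc_lt_last k).ne'
      (Fin.castSucc_lt_last l).ne']
  · rw [weightedSq, weightedSq, ← Finset.sum_sub_distrib,
      Finset.sum_eq_add k l hkl.ne ?_ (by simp) (by simp), hk, hl]
    · ring
    · rintro i _ ⟨hik, hil⟩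
      rw [hT, Equiv.swap_apply_of_ne_of_ne (by simpa using hik) (by simpa using hil), sub_self]

/-- The difference of the two diagonal entries is symmetrized under the swap of coordinates `k` and
`l`. With `w` for `weightedSq`, the factor `w(x)² - w(Tx)²` contains `(l - k)(x_l² - x_k²)`, so the
symmetrized integrand is nonnegative (`hsum`). -/
theorem blockCov_weightedForm_lt (e : ℕ) {k l : Fin n} (hkl : k < l) :
    blockCov (weightedForm e) k k < blockCov (weightedForm e) l l := by
  obtain ⟨T, hT⟩ := weightedSq_swap hkl
  have hc := continuous_weightedForm (n := n) e
  have hcT : Continuous T := T.continuous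
  have hkl' : (0 : ℝ) < (l : ℝ) - k := by
    have : (k : ℝ) < l := by exact_mod_cast hkl
    linarith
  set F : EuclideanSpace ℝ (Fin (n + 1)) → ℝ := fun x =>
    weightedForm e x ^ 2 * (x l.castSucc * x l.castSucc - x k.castSucc * x k.castSucc) with hF
  have hFc : Continuous F := by fun_prop
  have hdiff : blockCov (weightedForm e) l l - blockCov (weightedForm e) k k =
      ∫ x : Metric.sphere (0 : EuclideanSpace ℝ (Fin (n + 1))) 1, F x.1
        ∂(sphereMeasure (n + 1)) := by
    simp only [blockCov, Matrix.of_apply]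
    rw [← integral_sub (integrable_sphere
      (F := fun x => weightedForm e x ^ 2 * (x l.castSucc * x l.castSucc)) (by fun_prop))
      (integrable_sphere
      (F := fun x => weightedForm e x ^ 2 * (x k.castSucc * x k.castSucc)) (by fun_prop))]
    simp only [hF, mul_sub]
  have hsum : ∀ x, F x + F (T x) = (x (Fin.last n) ^ e) ^ 2 *
      (weightedSq x + weightedSq (T x)) * ((l : ℝ) - k) *
        (x l.castSucc ^ 2 - x k.castSucc ^ 2) ^ 2 := by
    intro x
    obtain ⟨h1, h2, h3, h4⟩ := hT x
    have h5 : weightedSq (T x) = weightedSq x -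
      ((l : ℝ) - k) * (x l.castSucc ^ 2 - x k.castSucc ^ 2) := by linarith
    simp only [hF, weightedForm, h1, h2, h3, h5]
    ring
  have htwice : 2 * ∫ x : Metric.sphere (0 : EuclideanSpace ℝ (Fin (n + 1))) 1, F x.1
        ∂(sphereMeasure (n + 1)) =
      ∫ x : Metric.sphere (0 : EuclideanSpace ℝ (Fin (n + 1))) 1, (F x.1 + F (T x.1))
        ∂(sphereMeasure (n + 1)) := by
    rw [integral_add (integrable_sphere hFc)
      (integrable_sphere (F := fun x => F (T x)) (hFc.comp hcT)), integral_sphere_comp T F, two_mul]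
  have hpos : 0 < ∫ x : Metric.sphere (0 : EuclideanSpace ℝ (Fin (n + 1))) 1,
      (F x.1 + F (T x.1)) ∂(sphereMeasure (n + 1)) := by
    -- A rational unit vector, from `3² + 4² = 5²`, with nonzero last coordinate and `y_l² ≠ y_k²`,
    -- so that the symmetrized integrand is positive there.
    set y : EuclideanSpace ℝ (Fin (n + 1)) :=
      EuclideanSpace.single (Fin.last n) (3 / 5) + EuclideanSpace.single l.castSucc (4 / 5) with hy
    have hyk : y k.castSucc = 0 := by
      simp [hy, (Fin.castSucc_lt_last k).ne, hkl.ne]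
    have hyl : y l.castSucc = 4 / 5 := by
      simp [hy, (Fin.castSucc_lt_last l).ne]
    have hyn : y (Fin.last n) = 3 / 5 := by
      simp [hy, (Fin.castSucc_lt_last l).ne']
    have hy1 : y ∈ Metric.sphere (0 : EuclideanSpace ℝ (Fin (n + 1))) 1 := by
      have horth : inner ℝ (EuclideanSpace.single (Fin.last n) (3 / 5 : ℝ))
          (EuclideanSpace.single l.castSucc (4 / 5 : ℝ)) = 0 := by
        rw [EuclideanSpace.inner_single_left]
        simp [(Fin.castSucc_lt_last l).ne']
      have := norm_add_sq_eq_norm_sq_add_norm_sq_of_inner_eq_zero _ _ horth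
      rw [mem_sphere_zero_iff_norm]
      simp only [← hy, PiLp.norm_single] at this
      norm_num at this
      nlinarith [norm_nonneg y]
    have hcont : Continuous fun x : Metric.sphere (0 : EuclideanSpace ℝ (Fin (n + 1))) 1 =>
        F x.1 + F (T x.1) := by fun_prop
    refine hcont.integral_pos_of_hasCompactSupport_nonneg_nonzero (x := ⟨y, hy1⟩)
      (HasCompactSupport.of_compactSpace _) (fun x => ?_) ?_
    · have h1 := weightedSq_nonneg x.1
      have h2 := weightedSq_nonneg (T x.1)
      simp only [hsum, Pi.zero_apply]
      positivity
    · have h2 := weightedSq_nonneg (T y)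
      have h1 : 0 < weightedSq y := by
        obtain ⟨-, -, -, h4⟩ := hT y
        rw [hyl, hyk] at h4
        nlinarith
      have h3 : 0 < weightedSq y + weightedSq (T y) := by linarith
      simp only [hsum, hyk, hyl, hyn]
      positivity
  linarith

theorem exists_det_krylov_ne_zero {d : ℕ} (hd : 2 ≤ d) :
    ∃ c : CoeffSpace n d, (krylov (blockCov (homForm c))).det ≠ 0 := by
  obtain ⟨c, hc⟩ := exists_homForm_eq_weightedForm (n := n) hd
  refine ⟨c, ?_⟩
  set a : Fin n → ℝ := fun i => blockCov (weightedForm (d - 2)) i i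
  have ha : StrictMono a := fun i j h => blockCov_weightedForm_lt (d - 2) h
  have hdiag : blockCov (weightedForm (d - 2)) = Matrix.diagonal a := by
    ext i j
    by_cases hij : i = j
    · subst hij; simp [a]
    · rw [blockCov_weightedForm_offDiag _ hij, Matrix.diagonal_apply_ne _ hij]
  rw [hc, hdiag]
  exact det_krylov_diagonal_ne_zero ha.injective

end Witness

/-! ### The hypersurface containing the exceptional set. -/

section Exceptional

variable {n d : ℕ}

/-- A polynomial in the coefficients of `f` whose non-vanishing forces `f` to have degree `d` and
its leading covariance block to have a simple spectrum. -/
def genericityPolynomial (m : exponents n d) : MvPolynomial (exponents n d) ℝ :=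
  MvPolynomial.X m * (krylov (genericCov n d)).det

theorem genericityPolynomial_ne_zero (hd : 2 ≤ d) (m : exponents n d) :
    genericityPolynomial m ≠ 0 := by
  refine mul_ne_zero (MvPolynomial.X_ne_zero m) fun h0 => ?_
  obtain ⟨c, hc⟩ := exists_det_krylov_ne_zero (n := n) hd
  apply hc
  rw [← genericCov_map, ← det_krylov_map, h0, map_zero]

/-- The factor `X m` makes a coefficient of degree `d` nonzero, so that `f` has degree exactly `d`
and its covariance block is the generic one; the Krylov factor then gives simple spectrum. -/
theorem hasDistinctPrincipalVariances_of_eval_ne_zero {m : exponents n d} (hm : m.1.degree = d)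
    {f : MvPolynomial (Fin n) ℝ} (hf : f.totalDegree ≤ d)
    (h : MvPolynomial.eval (coeffVector d f) (genericityPolynomial m) ≠ 0) :
    HasDistinctPrincipalVariances f := by
  rw [genericityPolynomial, map_mul, MvPolynomial.eval_X, det_krylov_map, genericCov_map] at h
  have hdeg : f.totalDegree = d := by
    refine le_antisymm hf ?_
    have hsupp : m.1 ∈ f.support := MvPolynomial.mem_support_iff.2 (left_ne_zero_of_mul h)
    have := MvPolynomial.le_totalDegree hsupp
    rwa [Finsupp.sum_fintype _ _ (by simp), ← Finsupp.degree_eq_sum, hm] at this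
  rw [hasDistinctPrincipalVariances_iff, leadingCov_eq_blockCov,
    funext (evalAt_homogenization f hdeg)]
  exact hasSimpleEigenvalues_of_det_krylov_ne_zero (isHermitian_blockCov _)
    (right_ne_zero_of_mul h)

theorem exceptionalSet_subset {m : exponents n d} (hm : m.1.degree = d) :
    exceptionalSet n d ⊆ {c | MvPolynomial.eval c (genericityPolynomial m) = 0} := by
  rintro _ ⟨f, ⟨hf, hnot⟩, rfl⟩
  by_contra h
  exact hnot (hasDistinctPrincipalVariances_of_eval_ne_zero hm hf h)

end Exceptional

end PWPCA

end

theorem mainTheorem4 (n d : ℕ) (hn : 2 ≤ n) (hd : 2 ≤ d) :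
    (∃ Z : Set (PWPCA.CoeffSpace n d), PWPCA.IsZariskiClosed Z ∧ Z ≠ Set.univ ∧
      PWPCA.exceptionalSet n d ⊆ Z) ∧
    MeasureTheory.volume (PWPCA.exceptionalSet n d) = 0 ∧
    (∀ f : MvPolynomial (Fin n) ℝ, f.totalDegree ≤ d →
      (PWPCA.HasDistinctPrincipalVariances f ↔
        PWPCA.HasSimpleEigenvalues (PWPCA.leadingCov f))) := by
  -- The exponent of `x_1^d`; any monomial of degree exactly `d` would do.
  let m : PWPCA.exponents n d :=
    ⟨Finsupp.single ⟨0, by omega⟩ d, PWPCA.mem_exponents.2 (by simp)⟩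
  have hm : m.1.degree = d := by simp [m]
  have hP := PWPCA.genericityPolynomial_ne_zero hd m
  have hsub := PWPCA.exceptionalSet_subset hm
  refine ⟨⟨_, ⟨Ideal.span {PWPCA.genericityPolynomial m}, ?_⟩, fun huniv => ?_, hsub⟩,
    MeasureTheory.measure_mono_null hsub (PWPCA.volume_eval_eq_zero hP),
    fun f _ => PWPCA.hasDistinctPrincipalVariances_iff f⟩
  · rw [MvPolynomial.zeroLocus_span]
    ext c
    simp [MvPolynomial.aeval_eq_eval]
  · refine hP (MvPolynomial.funext fun c => ?_)
    rw [map_zero]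
    exact huniv.ge (Set.mem_univ c)
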